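/- **Model.** Let $\mathbb T=\{w\in\mathbb C:|w|=1\}$ and let $\{e_\mu\}_{\mu\in\mathbb Z^2}$ be the standard basis of $l^2(\mathbb Z^2)$. Let $S_{\circlearrowleft}$ and $S_{\circlearrowright}$ be the unitary operators on $l^2(\mathbb Z^2)$ that permute the basis vectors cyclically, for all $j,k\in\mathbb Z$, by $$S_{\circlearrowleft}:\ e_{(2j,2k)}\mapsto e_{(2j+1,2k)}\mapsto e_{(2j+1,2k+1)}\mapsto e_{(2j,2k+1)}\mapsto e_{(2j,2k)},$$ $$S_{\circlearrowright}:\ e_{(2j,2k)}\mapsto e_{(2j,2k-1)}\mapsto e_{(2j-1,2k-1)}\mapsto e_{(2j-1,2k)}\mapsto e_{(2j,2k)},$$ and for $\varphi\in\mathbb R$ put $S(\varphi):=\cos\varphi\,S_{\circlearrowleft}+i\sin\varphi\,S_{\circlearrowright}$. For $\omega\in\mathbb T^{\mathbb Z^2}$ let $D_\omega e_\mu:=\omega_\mu e_\mu$ and $U_\omega(\varphi):=D_\omega S(\varphi)$, a unitary operator on $l^2(\mathbb Z^2)$. The space $\mathbb T^{\mathbb Z^2}$ carries the product probability measure $\mathbb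 P$ whose factors are the normalized Lebesgue measure on $\mathbb T$; $\mathbb E$ is the expectation. For $z\in\mathbb C\setminus\mathbb T$ write $R(\varphi,z)=R_\omega(\varphi,z):=(U_\omega(\varphi)-z)^{-1}$. **Geometry.** For $L=(L_1,L_2)$ with integers $L_1,L_2\ge 1$ let $|L|:=(L_1^2+L_2^2)^{1/2}$ and $$\Lambda_L:=\mathbb Z^2\cap\big([-2L_1,2L_1-1]\times[-2L_2+2,2L_2+1]\big).$$ For $A\subset\mathbb Z^2$ put $A^c:=\mathbb Z^2\setminus A$, $\ \mathring{A}:=\{\alpha\in A:\ \alpha+v\in A\ \text{ for all } v\in\mathbb Z^2 \text{ with } \|v\|_\infty=1\}$, $\ \partial A:=A\setminus\mathring{A}$, and $N(A):=\{\alpha+v:\ \alpha\in A,\ v\in\mathbb Z^2,\ \|v\|_\infty=1\}$. For $\mu\in\mathbb Z^2$ let $[\mu]:=(2\lfloor\mu_1/2\rfloor,2\lfloor\mu_2/2\rfloor)$. **Proposition.** For every $s\in(0,1)$ there exist $\ell_0>0$, $\varphi_0>0$ and $q<1$ such that, for all $L$ as above with $|L|>\ell_0$, all $z\in\mathbb C\setminus\mathbb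 T$, all real $\varphi$ with $|\varphi|<\varphi_0$, all $\mu\in\mathbb Z^2$ and all $\nu$ in the interior of $(\Lambda_L+[\mu])^c$, the random variables $|\langle e_\beta,R(\varphi,z)e_\nu\rangle|^s$, $\beta\in\mathbb Z^2$, are integrable and $$\mathbb E\big(|\langle e_\mu,R(\varphi,z)e_\nu\rangle|^s\big)\ \le\ q\max_{\beta\in N\left(\partial\left((\Lambda_L+[\mu])^c\right)\right)}\mathbb E\big(|\langle e_\beta,R(\varphi,z)e_\nu\rangle|^s\big).$$ -/

import Mathlib

open MeasureTheory
open scoped ENNReal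

noncomputable section

namespace ChalkerCoddington

/-- The lattice `ℤ²`. -/
abbrev Site : Type := ℤ × ℤ

/-- The Hilbert space `l²(ℤ²)`. -/
abbrev Hilb : Type := lp (fun _ : Site => ℂ) 2

/-- The standard basis vector `e_μ`. -/
def e (μ : Site) : Hilb := lp.single 2 μ 1

/-- One anticlockwise step:
`(2j,2k) ↦ (2j+1,2k) ↦ (2j+1,2k+1) ↦ (2j,2k+1) ↦ (2j,2k)`. -/
def ccwStep (μ : Site) : Site :=
  if μ.1 % 2 = 0 then
    if μ.2 % 2 = 0 then (μ.1 + 1, μ.2) else (μ.1, μ.2 - 1)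
  else
    if μ.2 % 2 = 0 then (μ.1, μ.2 + 1) else (μ.1 - 1, μ.2)

/-- The inverse of `ccwStep`. -/
def ccwBack (μ : Site) : Site :=
  if μ.1 % 2 = 0 then
    if μ.2 % 2 = 0 then (μ.1, μ.2 + 1) else (μ.1 + 1, μ.2)
  else
    if μ.2 % 2 = 0 then (μ.1 - 1, μ.2) else (μ.1, μ.2 - 1)

/-- One clockwise step:
`(2j,2k) ↦ (2j,2k-1) ↦ (2j-1,2k-1) ↦ (2j-1,2k) ↦ (2j,2k)`. -/
def cwStep (μ : Site) : Site :=
  if μ.1 % 2 = 0 then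
    if μ.2 % 2 = 0 then (μ.1, μ.2 - 1) else (μ.1 - 1, μ.2)
  else
    if μ.2 % 2 = 0 then (μ.1 + 1, μ.2) else (μ.1, μ.2 + 1)

/-- The inverse of `cwStep`. -/
def cwBack (μ : Site) : Site :=
  if μ.1 % 2 = 0 then
    if μ.2 % 2 = 0 then (μ.1 - 1, μ.2) else (μ.1, μ.2 + 1)
  else
    if μ.2 % 2 = 0 then (μ.1, μ.2 - 1) else (μ.1 + 1, μ.2)

/-- The anticlockwise permutation of `ℤ²`. -/
def ccwPerm : Equiv.Perm Site where
  toFun := ccwStep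
  invFun := ccwBack
  left_inv := by
    rintro ⟨a, b⟩
    simp only [ccwStep, ccwBack]
    grind
  right_inv := by
    rintro ⟨a, b⟩
    simp only [ccwStep, ccwBack]
    grind

/-- The clockwise permutation of `ℤ²`. -/
def cwPerm : Equiv.Perm Site where
  toFun := cwStep
  invFun := cwBack
  left_inv := by
    rintro ⟨a, b⟩
    simp only [cwStep, cwBack]
    grind
  right_inv := by
    rintro ⟨a, b⟩
    simp only [cwStep, cwBack]
    grind

theorem memLp_perm (σ : Equiv.Perm Site) (x : Hilb) :
    Memℓp (fun μ => x (σ.symm μ)) 2 := by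
  have h := (memℓp_gen_iff (p := 2) (by norm_num)).1 (lp.memℓp x)
  exact (memℓp_gen_iff (p := 2) (by norm_num)).2 ((Equiv.summable_iff σ.symm).2 h)

theorem memLp_phase (ω : Site → Circle) (x : Hilb) :
    Memℓp (fun μ => (ω μ : ℂ) * x μ) 2 := by
  have h := (memℓp_gen_iff (p := 2) (by norm_num)).1 (lp.memℓp x)
  refine (memℓp_gen_iff (p := 2) (by norm_num)).2 ?_
  simpa only [norm_mul, Circle.norm_coe, one_mul] using h

/-- The unitary operator on `l²(ℤ²)` with `e_μ ↦ e_{σ μ}`. -/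
def permOp (σ : Equiv.Perm Site) : Hilb ≃ₗᵢ[ℂ] Hilb where
  toFun x := ⟨fun μ => x (σ.symm μ), memLp_perm σ x⟩
  invFun x := ⟨fun μ => x (σ μ), memLp_perm σ.symm x⟩
  map_add' x y := by ext μ; rfl
  map_smul' c x := by ext μ; rfl
  left_inv x := by ext μ; simp
  right_inv x := by ext μ; simp
  norm_map' x := by
    rw [lp.norm_eq_tsum_rpow (by norm_num), lp.norm_eq_tsum_rpow (by norm_num)]
    congr 1
    exact Equiv.tsum_eq σ.symm (fun μ => ‖x μ‖ ^ (2 : ℝ≥0∞).toReal)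

theorem permOp_e (σ : Equiv.Perm Site) (μ : Site) : permOp σ (e μ) = e (σ μ) := by
  ext ν
  change (Pi.single μ (1 : ℂ) : Site → ℂ) (σ.symm ν) = (Pi.single (σ μ) (1 : ℂ) : Site → ℂ) ν
  simp only [Pi.single_apply, Equiv.symm_apply_eq]

/-- The diagonal unitary operator `D_ω`: `e_μ ↦ ω_μ e_μ`. -/
def phaseOp (ω : Site → Circle) : Hilb ≃ₗᵢ[ℂ] Hilb where
  toFun x := ⟨fun μ => (ω μ : ℂ) * x μ, memLp_phase ω x⟩
  invFun x := ⟨fun μ => ((ω μ)⁻¹ : Circle) * x μ, memLp_phase (fun μ => (ω μ)⁻¹) x⟩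
  map_add' x y := by ext μ; exact mul_add _ _ _
  map_smul' c x := by ext μ; exact mul_left_comm _ _ _
  left_inv x := by ext μ; simp
  right_inv x := by ext μ; simp
  norm_map' x := by
    rw [lp.norm_eq_tsum_rpow (by norm_num), lp.norm_eq_tsum_rpow (by norm_num)]
    congr 1
    refine tsum_congr fun μ => ?_
    change ‖(ω μ : ℂ) * x μ‖ ^ (2 : ℝ≥0∞).toReal = _
    rw [norm_mul, Circle.norm_coe, one_mul]

/-- `S_↺`, the direct sum of the anticlockwise rotations of the blocks
`{(2j,2k), (2j+1,2k), (2j+1,2k+1), (2j,2k+1)}`. -/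
def Sccw : Hilb →L[ℂ] Hilb := (permOp ccwPerm : Hilb →L[ℂ] Hilb)

/-- `S_↻`, the direct sum of the clockwise rotations of the blocks
`{(2j,2k), (2j,2k-1), (2j-1,2k-1), (2j-1,2k)}`. -/
def Scw : Hilb →L[ℂ] Hilb := (permOp cwPerm : Hilb →L[ℂ] Hilb)

/-- `S(φ) = cos φ S_↺ + i sin φ S_↻`. -/
def S (φ : ℝ) : Hilb →L[ℂ] Hilb :=
  (Real.cos φ : ℂ) • Sccw + (Complex.I * (Real.sin φ : ℂ)) • Scw

/-- `U_ω(φ) = D_ω S(φ)`. -/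
def U (φ : ℝ) (ω : Site → Circle) : Hilb →L[ℂ] Hilb :=
  (phaseOp ω : Hilb →L[ℂ] Hilb) * S φ

/-- The resolvent `R_ω(φ,z) = (U_ω(φ) - z)⁻¹`. -/
def R (φ : ℝ) (z : ℂ) (ω : Site → Circle) : Hilb →L[ℂ] Hilb :=
  Ring.inverse (U φ ω - algebraMap ℂ (Hilb →L[ℂ] Hilb) z)

theorem backSteps_comm (σ τ : Equiv.Perm Site) (h : ∀ μ, σ.symm (τ μ) = τ.symm (σ μ)) :
    ((permOp σ).symm : Hilb →L[ℂ] Hilb) * ((permOp τ : Hilb ≃ₗᵢ[ℂ] Hilb) : Hilb →L[ℂ] Hilb)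
      = ((permOp τ).symm : Hilb →L[ℂ] Hilb) * ((permOp σ : Hilb ≃ₗᵢ[ℂ] Hilb) : Hilb →L[ℂ] Hilb) := by
  ext x μ
  change x (τ.symm (σ μ)) = x (σ.symm (τ μ))
  rw [h]

theorem foreSteps_comm (σ τ : Equiv.Perm Site) (h : ∀ μ, σ (τ.symm μ) = τ (σ.symm μ)) :
    ((permOp σ : Hilb ≃ₗᵢ[ℂ] Hilb) : Hilb →L[ℂ] Hilb) * ((permOp τ).symm : Hilb →L[ℂ] Hilb)
      = ((permOp τ : Hilb ≃ₗᵢ[ℂ] Hilb) : Hilb →L[ℂ] Hilb) * ((permOp σ).symm : Hilb →L[ℂ] Hilb) := by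
  ext x μ
  change x (τ (σ.symm μ)) = x (σ (τ.symm μ))
  rw [h]

theorem isometry_mem_unitary (u : Hilb ≃ₗᵢ[ℂ] Hilb) :
    (u : Hilb →L[ℂ] Hilb) ∈ unitary (Hilb →L[ℂ] Hilb) := by
  rw [Unitary.mem_iff, LinearIsometryEquiv.star_eq_symm]
  constructor <;> ext x <;> simp

theorem star_S (φ : ℝ) : star (S φ) =
    (Real.cos φ : ℂ) • ((permOp ccwPerm).symm : Hilb →L[ℂ] Hilb)
      - (Complex.I * (Real.sin φ : ℂ)) • ((permOp cwPerm).symm : Hilb →L[ℂ] Hilb) := by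
  unfold S Sccw Scw
  rw [star_add, star_smul, star_smul, LinearIsometryEquiv.star_eq_symm,
    LinearIsometryEquiv.star_eq_symm, sub_eq_add_neg, ← neg_smul]
  simp only [RCLike.star_def, map_mul, Complex.conj_I, Complex.conj_ofReal, neg_mul]

theorem cos_sin_combination (φ : ℝ) {A A' B B' : Hilb →L[ℂ] Hilb} (hA : A' * A = 1)
    (hB : B' * B = 1) (h : A' * B = B' * A) :
    ((Real.cos φ : ℂ) • A' - (Complex.I * (Real.sin φ : ℂ)) • B') *
      ((Real.cos φ : ℂ) • A + (Complex.I * (Real.sin φ : ℂ)) • B) = 1 := by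
  rw [sub_mul, mul_add, mul_add, smul_mul_smul_comm, smul_mul_smul_comm, smul_mul_smul_comm,
    smul_mul_smul_comm, hA, hB, h]
  have h1 : (Real.cos φ : ℂ) * (Real.cos φ : ℂ)
      - Complex.I * (Real.sin φ : ℂ) * (Complex.I * (Real.sin φ : ℂ)) = 1 := by
    have h2 : (Real.cos φ : ℂ) ^ 2 + (Real.sin φ : ℂ) ^ 2 = 1 := by
      exact_mod_cast Real.cos_sq_add_sin_sq φ
    linear_combination h2 - (Real.sin φ : ℂ) ^ 2 * Complex.I_sq
  rw [mul_comm (Complex.I * (Real.sin φ : ℂ)) (Real.cos φ : ℂ), add_sub_add_comm,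
    sub_eq_add_neg, sub_eq_add_neg]
  have h3 := congrArg (fun c : ℂ => c • (1 : Hilb →L[ℂ] Hilb)) h1
  simp only [sub_smul, one_smul] at h3
  refine Eq.trans ?_ h3
  abel

theorem S_mem_unitary (φ : ℝ) : S φ ∈ unitary (Hilb →L[ℂ] Hilb) := by
  have hA := isometry_mem_unitary (permOp ccwPerm)
  have hB := isometry_mem_unitary (permOp cwPerm)
  rw [Unitary.mem_iff, LinearIsometryEquiv.star_eq_symm] at hA hB
  rw [Unitary.mem_iff, star_S]
  refine ⟨cos_sin_combination φ hA.1 hB.1 (backSteps_comm _ _ ?_), ?_⟩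
  · rintro ⟨a, b⟩
    simp only [ccwPerm, cwPerm, Equiv.coe_fn_mk, Equiv.coe_fn_symm_mk, ccwStep, ccwBack, cwStep,
      cwBack]
    grind
  · have h := cos_sin_combination (-φ) hA.2 hB.2 (foreSteps_comm _ _ ?_)
    · simp only [Real.cos_neg, Real.sin_neg, Complex.ofReal_neg, mul_neg, neg_smul,
        sub_neg_eq_add, ← sub_eq_add_neg] at h
      exact h
    · rintro ⟨a, b⟩
      simp only [ccwPerm, cwPerm, Equiv.coe_fn_mk, Equiv.coe_fn_symm_mk, ccwStep, ccwBack, cwStep,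
        cwBack]
      grind

/-- `U_ω(φ)` is unitary. -/
theorem U_mem_unitary (φ : ℝ) (ω : Site → Circle) : U φ ω ∈ unitary (Hilb →L[ℂ] Hilb) :=
  mul_mem (isometry_mem_unitary (phaseOp ω)) (S_mem_unitary φ)

/-- `U_ω(φ) - z` is invertible for every `z` off the unit circle, so that `R φ z ω` is
its genuine inverse. -/
theorem isUnit_U_sub (φ : ℝ) (ω : Site → Circle) {z : ℂ} (hz : ‖z‖ ≠ 1) :
    IsUnit (U φ ω - algebraMap ℂ (Hilb →L[ℂ] Hilb) z) := by
  have h : z ∉ spectrum ℂ (U φ ω) := fun hmem =>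
    hz (by simpa using spectrum.subset_circle_of_unitary (U_mem_unitary φ ω) hmem)
  rw [spectrum.notMem_iff] at h
  simpa using h.neg

/-- The Borel σ-algebra of the circle. -/
instance : MeasurableSpace Circle := borel Circle

instance : BorelSpace Circle := ⟨rfl⟩

/-- The normalized Lebesgue measure `dℓ` on the circle. -/
def circleMeasure : Measure Circle :=
  (volume.restrict (Set.Ioc (0 : ℝ) 1)).map fun t => Circle.exp (2 * Real.pi * t)

instance : IsProbabilityMeasure circleMeasure := by
  have : IsProbabilityMeasure (volume.restrict (Set.Ioc (0 : ℝ) 1)) := ⟨by simp⟩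
  exact Measure.isProbabilityMeasure_map
    (Circle.exp.continuous.comp (continuous_const.mul continuous_id)).measurable.aemeasurable

/-- The product measure `ℙ = ⊗ dℓ` on `𝕋^{ℤ²}`: independent uniform phases. -/
def P : Measure (Site → Circle) := Measure.infinitePi fun _ => circleMeasure

/-- The random variable `|⟨e_μ, R(φ,z) e_ν⟩|^s`. -/
def resolventPower (s φ : ℝ) (z : ℂ) (μ ν : Site) (ω : Site → Circle) : ℝ :=
  ‖inner ℂ (e μ) (R φ z ω (e ν))‖ ^ s

/-- The fractional moment `𝔼(|⟨e_μ, R(φ,z) e_ν⟩|^s)`. -/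
def fracMoment (s φ : ℝ) (z : ℂ) (μ ν : Site) : ℝ :=
  ∫ ω, resolventPower s φ z μ ν ω ∂P

/-- The maximum norm on `ℤ²`. -/
def supNorm (v : Site) : ℤ := max |v.1| |v.2|

/-- The box `Λ_L = ℤ² ∩ ([-2L₁, 2L₁-1] × [-2L₂+2, 2L₂+1])`. -/
def box (L : ℕ × ℕ) : Set Site :=
  {α | (-2 * (L.1 : ℤ) ≤ α.1 ∧ α.1 ≤ 2 * (L.1 : ℤ) - 1) ∧
    (-2 * (L.2 : ℤ) + 2 ≤ α.2 ∧ α.2 ≤ 2 * (L.2 : ℤ) + 1)}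

/-- The shifted set `A + v`. -/
def shift (A : Set Site) (v : Site) : Set Site := {α | ∃ β ∈ A, α = β + v}

/-- `[μ]`, the site with both coordinates even in the anticlockwise block of `μ`. -/
def blockBase (μ : Site) : Site := (2 * (μ.1 / 2), 2 * (μ.2 / 2))

/-- The interior of `A`: the sites of `A` all of whose neighbours lie in `A`. -/
def latticeInterior (A : Set Site) : Set Site := {α | α ∈ A ∧ ∀ v : Site, supNorm v = 1 → α + v ∈ A}

/-- The boundary `∂A = A \ int A`. -/
def bdry (A : Set Site) : Set Site := A \ latticeInterior A

/-- The nearest neighbourhood `N(A)`. -/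
def nbhd (A : Set Site) : Set Site := {β | ∃ α ∈ A, ∃ v : Site, supNorm v = 1 ∧ β = α + v}

/-- The Euclidean length `|L|`. -/
def size (L : ℕ × ℕ) : ℝ := Real.sqrt ((L.1 : ℝ) ^ 2 + (L.2 : ℝ) ^ 2)

end ChalkerCoddington

end

namespace ChalkerCoddington

/-! At `φ = 0` the operator splits into anticlockwise blocks of four sites, and the resolvent
vanishes at every block without the source `ν`. For small `φ` a block off the source is fed only
through the clockwise steps, with weight `sin φ`. Going once around the ring (`norm_mul_ring_le`)
expresses the resolvent at `b` by its values at the four entry sites, divided by `z ^ 4 - u` with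
`u` the product of the ring's phases and `cos φ ^ 4`.

This denominator may be small, but flipping the phase at `b` turns `u` into `-u`, and `z ^ 4 - u`,
`z ^ 4 + u` cannot both be small. So the bound of order `|φ|` holds at `ω` or at the flipped
configuration (`ring_bound`). One good value of the phase suffices: changing it is a rank-one
perturbation, so the resolvent at `b` is its value at the good phase divided by an affine function
of the new one, whose inverse `s`-moment is uniformly bounded because `s < 1`
(`lintegral_resolvent_update_le`).

Averaging gives a fractional moment of at most a constant times `|φ| ^ s` times the sum over the
entry sites. For small `φ` this is at most half of the largest entry moment, and a discrete maximum
principle (`le_half_of_submean`) carries the factor `1 / 2` to the boundary of the box. The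
smallness comes from `φ`, not from the size of the box. -/

theorem e_apply (μ ν : Site) : (e μ : Hilb) ν = (Pi.single μ (1 : ℂ) : Site → ℂ) ν := rfl

theorem e_apply_self (μ : Site) : (e μ : Hilb) μ = 1 := by simp [e_apply]

theorem e_apply_of_ne {μ ν : Site} (h : ν ≠ μ) : (e μ : Hilb) ν = 0 := by
  simp [e_apply, h]

theorem norm_e (μ : Site) : ‖e μ‖ = 1 := by
  simp [e, lp.norm_single]

theorem inner_e (μ : Site) (x : Hilb) : inner ℂ (e μ) x = x μ := by
  rw [e, lp.inner_single_left]
  simp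

/-! ### Coordinates of the operators and the resolvent equation -/

theorem S_apply (φ : ℝ) (x : Hilb) (β : Site) :
    S φ x β = (Real.cos φ : ℂ) * x (ccwBack β) + Complex.I * (Real.sin φ : ℂ) * x (cwBack β) := rfl

theorem U_apply (φ : ℝ) (ω : Site → Circle) (x : Hilb) (β : Site) :
    U φ ω x β = (ω β : ℂ) * S φ x β := rfl

/-- A phase acts only on its own output coordinate, so the change has rank one. This makes the
dependence of the resolvent on one phase explicit. -/
theorem U_update (φ : ℝ) (ω : Site → Circle) (b : Site) (t : Circle) (x : Hilb) :
    U φ (Function.update ω b t) x = U φ ω x + (((t : ℂ) - ω b) * S φ x b) • e b := by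
  ext β
  rw [U_apply]
  change _ = U φ ω x β + (((t : ℂ) - ω b) * S φ x b) * (e b : Hilb) β
  rw [U_apply]
  rcases eq_or_ne β b with rfl | h
  · rw [e_apply_self, Function.update_self]
    ring
  · rw [e_apply_of_ne h, Function.update_of_ne h]
    ring

theorem R_apply_sub (φ : ℝ) {z : ℂ} (hz : ‖z‖ ≠ 1) (ω : Site → Circle) (x : Hilb) :
    R φ z ω (U φ ω x - z • x) = x := by
  have h := Ring.inverse_mul_cancel _ (isUnit_U_sub φ ω hz)
  exact DFunLike.congr_fun h x

theorem sub_apply_R (φ : ℝ) {z : ℂ} (hz : ‖z‖ ≠ 1) (ω : Site → Circle) (x : Hilb) :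
    U φ ω (R φ z ω x) - z • R φ z ω x = x := by
  have h := Ring.mul_inverse_cancel _ (isUnit_U_sub φ ω hz)
  exact DFunLike.congr_fun h x

theorem norm_U_apply (φ : ℝ) (ω : Site → Circle) (x : Hilb) : ‖U φ ω x‖ = ‖x‖ :=
  (ContinuousLinearMap.norm_map_iff_adjoint_comp_self (U φ ω)).2
    (Unitary.mem_iff.1 (U_mem_unitary φ ω)).1 x

theorem le_norm_U_sub (φ : ℝ) (z : ℂ) (ω : Site → Circle) (x : Hilb) :
    |1 - ‖z‖| * ‖x‖ ≤ ‖U φ ω x - z • x‖ := by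
  have h := abs_norm_sub_norm_le (U φ ω x) (z • x)
  rw [norm_U_apply, norm_smul] at h
  refine le_trans (le_of_eq ?_) h
  rw [← one_sub_mul, abs_mul, abs_norm]

/-- The resolvent equation away from the source. -/
theorem resolvent_eq (φ : ℝ) {z : ℂ} (hz : ‖z‖ ≠ 1) (ω : Site → Circle) {β ν : Site} (h : β ≠ ν) :
    z * R φ z ω (e ν) β = (ω β : ℂ) * S φ (R φ z ω (e ν)) β := by
  have h1 := congrArg (fun x : Hilb => x β) (sub_apply_R φ hz ω (e ν))
  change U φ ω (R φ z ω (e ν)) β - z * R φ z ω (e ν) β = (e ν : Hilb) β at h1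
  rw [e_apply_of_ne h, U_apply] at h1
  linear_combination -h1

/-- Dependence of the resolvent at `b` on the single phase `ω b`. -/
theorem resolvent_update (φ : ℝ) {z : ℂ} (hz : ‖z‖ ≠ 1) (ω : Site → Circle) {b ν : Site}
    (h : b ≠ ν) (t : Circle) :
    R φ z (Function.update ω b t) (e ν) b *
      ((1 + z * R φ z ω (e b) b) * t - z * R φ z ω (e b) b * ω b) = t * R φ z ω (e ν) b := by
  set y : Hilb := R φ z (Function.update ω b t) (e ν) with hy
  -- The updated resolvent vector solves the equation for the old phases with an extra source at
  -- `b`.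
  have h1 : U φ ω y - z • y = e ν - (((t : ℂ) - ω b) * S φ y b) • e b := by
    have := sub_apply_R φ hz (Function.update ω b t) (e ν)
    rw [← hy, U_update] at this
    rw [← this]
    abel
  have h2 : y = R φ z ω (e ν) - (((t : ℂ) - ω b) * S φ y b) • R φ z ω (e b) := by
    rw [← map_smul, ← map_sub, ← h1, R_apply_sub φ hz]
  have h3 : y b = R φ z ω (e ν) b - (((t : ℂ) - ω b) * S φ y b) * R φ z ω (e b) b :=
    congrArg (fun x : Hilb => x b) h2
  have h4 : z * y b = (t : ℂ) * S φ y b := by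
    have := resolvent_eq φ hz (Function.update ω b t) h
    rwa [Function.update_self] at this
  -- The unknown `S φ y b` is eliminated by means of `h4`.
  linear_combination (t : ℂ) * h3 + (t - ω b) * R φ z ω (e b) b * h4

/-! ### Boundedness and continuity in the phases, integrability -/

theorem norm_R_le (φ : ℝ) {z : ℂ} (hz : ‖z‖ ≠ 1) (ω : Site → Circle) (ν : Site) :
    ‖R φ z ω (e ν)‖ ≤ |1 - ‖z‖|⁻¹ := by
  have h := le_norm_U_sub φ z ω (R φ z ω (e ν))
  rw [sub_apply_R φ hz, norm_e] at h
  have h0 : 0 < |1 - ‖z‖| := abs_pos.2 (sub_ne_zero.2 (Ne.symm hz))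
  rwa [← one_div, le_div_iff₀ h0, mul_comm]

/-- The product topology controls only finitely many phases at a time, so continuity is claimed on a
fixed vector only. It follows by dominated convergence with majorant `4 * ‖x μ‖ ^ 2`. -/
theorem continuous_phase (x : Hilb) : Continuous fun ω : Site → Circle => phaseOp ω x := by
  rw [continuous_iff_continuousAt]
  intro ω₀
  rw [ContinuousAt, tendsto_iff_norm_sub_tendsto_zero]
  have h2 : (0 : ℝ) < (2 : ℝ≥0∞).toReal := by norm_num
  have hx : Summable fun μ => 4 * ‖x μ‖ ^ 2 := by
    have := (memℓp_gen_iff h2).1 (lp.memℓp x)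
    simp only [ENNReal.toReal_ofNat, Real.rpow_ofNat] at this
    exact this.mul_left 4
  have hlim : Filter.Tendsto (fun ω : Site → Circle => ∑' μ, ‖((ω μ : ℂ) - ω₀ μ) * x μ‖ ^ 2)
      (nhds ω₀) (nhds (∑' μ : Site, (0 : ℝ))) := by
    refine tendsto_tsum_of_dominated_convergence hx ?_ ?_
    · intro μ
      have hc : Continuous fun ω : Site → Circle => ‖((ω μ : ℂ) - ω₀ μ) * x μ‖ ^ 2 := by fun_prop
      simpa using hc.tendsto ω₀
    · refine Filter.Eventually.of_forall fun ω μ => ?_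
      rw [norm_mul, mul_pow, norm_mul, norm_pow, norm_pow, norm_norm, norm_norm]
      have : ‖(ω μ : ℂ) - ω₀ μ‖ ≤ 2 := by
        refine (norm_sub_le _ _).trans (le_of_eq ?_)
        rw [Circle.norm_coe, Circle.norm_coe]
        norm_num
      have h4 : ‖(ω μ : ℂ) - ω₀ μ‖ ^ 2 ≤ 4 := by nlinarith [norm_nonneg ((ω μ : ℂ) - ω₀ μ)]
      gcongr
  rw [tsum_zero] at hlim
  have hn : ∀ ω : Site → Circle, ‖phaseOp ω x - phaseOp ω₀ x‖
      = Real.sqrt (∑' μ, ‖((ω μ : ℂ) - ω₀ μ) * x μ‖ ^ 2) := by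
    intro ω
    rw [lp.norm_eq_tsum_rpow h2, Real.sqrt_eq_rpow]
    simp only [ENNReal.toReal_ofNat, Real.rpow_ofNat]
    congr 1
    refine tsum_congr fun μ => ?_
    change ‖(ω μ : ℂ) * x μ - ω₀ μ * x μ‖ ^ 2 = _
    rw [sub_mul]
  simp only [hn]
  simpa using hlim.sqrt

/-- By the resolvent identity the difference of the resolvents is driven by the difference of the
phase operators on the fixed vector `S φ y`, so strong continuity suffices. -/
theorem continuous_resolvent (φ : ℝ) {z : ℂ} (hz : ‖z‖ ≠ 1) (ν : Site) :
    Continuous fun ω : Site → Circle => R φ z ω (e ν) := by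
  have h0 : 0 < |1 - ‖z‖| := abs_pos.2 (sub_ne_zero.2 (Ne.symm hz))
  rw [continuous_iff_continuousAt]
  intro ω₀
  rw [ContinuousAt, tendsto_iff_norm_sub_tendsto_zero]
  set y : Hilb := R φ z ω₀ (e ν) with hy
  have hlim : Filter.Tendsto (fun ω : Site → Circle =>
      |1 - ‖z‖|⁻¹ * ‖phaseOp ω (S φ y) - phaseOp ω₀ (S φ y)‖) (nhds ω₀) (nhds 0) := by
    have := (continuous_phase (S φ y)).tendsto ω₀
    rw [tendsto_iff_norm_sub_tendsto_zero] at this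
    simpa using this.const_mul |1 - ‖z‖|⁻¹
  refine squeeze_zero (fun _ => norm_nonneg _) (fun ω => ?_) hlim
  have h := le_norm_U_sub φ z ω (R φ z ω (e ν) - y)
  have h1 : U φ ω (R φ z ω (e ν) - y) - z • (R φ z ω (e ν) - y)
      = -(phaseOp ω (S φ y) - phaseOp ω₀ (S φ y)) := by
    have e1 := sub_apply_R φ hz ω (e ν)
    have e2 := sub_apply_R φ hz ω₀ (e ν)
    rw [← hy] at e2
    rw [map_sub, smul_sub, sub_sub_sub_comm, e1, ← e2]
    change U φ ω₀ y - z • y - (phaseOp ω (S φ y) - z • y) = _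
    change phaseOp ω₀ (S φ y) - z • y - (phaseOp ω (S φ y) - z • y) = _
    abel
  rw [h1, norm_neg] at h
  rwa [inv_mul_eq_div, le_div_iff₀ h0, mul_comm]

theorem continuous_resolvent_apply (φ : ℝ) {z : ℂ} (hz : ‖z‖ ≠ 1) (β ν : Site) :
    Continuous fun ω : Site → Circle => R φ z ω (e ν) β := by
  have : Continuous fun ω : Site → Circle => inner ℂ (e β) (R φ z ω (e ν)) :=
    continuous_const.inner (continuous_resolvent φ hz ν)
  simpa only [inner_e] using this

instance : IsProbabilityMeasure P := by unfold P; infer_instance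

theorem integrable_resolventPower {s : ℝ} (hs : 0 < s) (φ : ℝ) {z : ℂ} (hz : ‖z‖ ≠ 1)
    (β ν : Site) : Integrable (resolventPower s φ z β ν) P := by
  have hc : Continuous (resolventPower s φ z β ν) := by
    unfold resolventPower
    simp only [inner_e]
    exact (continuous_resolvent_apply φ hz β ν).norm.rpow_const fun _ => Or.inr hs.le
  refine Integrable.of_bound hc.measurable.aestronglyMeasurable (|1 - ‖z‖|⁻¹ ^ s)
    (Filter.Eventually.of_forall fun ω => ?_)
  rw [resolventPower, inner_e, Real.norm_of_nonneg (by positivity)]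
  gcongr
  exact (lp.norm_apply_le_norm (by norm_num) _ β).trans (norm_R_le φ hz ω ν)

theorem ofReal_fracMoment {s : ℝ} (hs : 0 < s) (φ : ℝ) {z : ℂ} (hz : ‖z‖ ≠ 1) (β ν : Site) :
    ENNReal.ofReal (fracMoment s φ z β ν) = ∫⁻ ω, ‖R φ z ω (e ν) β‖ₑ ^ s ∂P := by
  rw [fracMoment, ofReal_integral_eq_lintegral_ofReal (integrable_resolventPower hs φ hz β ν)
    (Filter.Eventually.of_forall fun ω => by unfold resolventPower; positivity)]
  refine lintegral_congr fun ω => ?_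
  rw [resolventPower, inner_e, ← ENNReal.ofReal_rpow_of_nonneg (norm_nonneg _) hs.le,
    ofReal_norm]

theorem fracMoment_nonneg (s φ : ℝ) (z : ℂ) (β ν : Site) : 0 ≤ fracMoment s φ z β ν :=
  integral_nonneg fun ω => by unfold resolventPower; positivity

/-! ### The resolvent on one anticlockwise block -/

/-- Going once around a ring of four sites. -/
theorem norm_mul_ring_le {z c σ w₀ w₁ w₂ w₃ x₀ x₁ x₂ x₃ g₀ g₁ g₂ g₃ : ℂ}
    (hc : ‖c‖ ≤ 1) (h₀ : ‖w₀‖ = 1) (h₁ : ‖w₁‖ = 1) (h₂ : ‖w₂‖ = 1) (h₃ : ‖w₃‖ = 1)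
    (e₀ : z * x₀ = w₀ * (c * x₁ + σ * g₀)) (e₁ : z * x₁ = w₁ * (c * x₂ + σ * g₁))
    (e₂ : z * x₂ = w₂ * (c * x₃ + σ * g₂)) (e₃ : z * x₃ = w₃ * (c * x₀ + σ * g₃)) :
    ‖x₀‖ * ‖z ^ 4 - w₀ * (w₁ * w₂ * w₃ * c ^ 4)‖ ≤
      ‖σ‖ * max 1 ‖z‖ ^ 3 * (‖g₀‖ + ‖g₁‖ + ‖g₂‖ + ‖g₃‖) := by
  have h : x₀ * (z ^ 4 - w₀ * (w₁ * w₂ * w₃ * c ^ 4)) =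
      σ * (z ^ 3 * w₀ * g₀ + z ^ 2 * (w₀ * w₁ * c) * g₁ + z * (w₀ * w₁ * w₂ * c ^ 2) * g₂
        + w₀ * w₁ * w₂ * w₃ * c ^ 3 * g₃) := by
    -- Each equation is substituted into the previous one; the fourth returns to `x₀`.
    linear_combination z ^ 3 * e₀ + z ^ 2 * w₀ * c * e₁ + z * w₀ * w₁ * c ^ 2 * e₂
      + w₀ * w₁ * w₂ * c ^ 3 * e₃
  rw [← norm_mul, h, norm_mul, mul_assoc ‖σ‖]
  refine mul_le_mul_of_nonneg_left ?_ (norm_nonneg _)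
  set m := max 1 ‖z‖
  have m1 : 1 ≤ m := le_max_left _ _
  have mz : ‖z‖ ≤ m := le_max_right _ _
  have c2 : ‖c‖ ^ 2 ≤ 1 := pow_le_one₀ (norm_nonneg _) hc
  have c3 : ‖c‖ ^ 3 ≤ 1 := pow_le_one₀ (norm_nonneg _) hc
  have a0 : ‖z ^ 3 * w₀ * g₀‖ ≤ m ^ 3 * ‖g₀‖ := by
    rw [norm_mul, norm_mul, h₀, mul_one, norm_pow]; gcongr
  have a1 : ‖z ^ 2 * (w₀ * w₁ * c) * g₁‖ ≤ m ^ 3 * ‖g₁‖ := by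
    simp only [norm_mul, h₀, h₁, one_mul, norm_pow]
    gcongr
    calc ‖z‖ ^ 2 * ‖c‖ ≤ m ^ 2 * 1 := by gcongr
      _ ≤ m ^ 2 * m := by gcongr
      _ = m ^ 3 := by ring
  have a2 : ‖z * (w₀ * w₁ * w₂ * c ^ 2) * g₂‖ ≤ m ^ 3 * ‖g₂‖ := by
    simp only [norm_mul, h₀, h₁, h₂, one_mul, norm_pow]
    gcongr
    calc ‖z‖ * ‖c‖ ^ 2 ≤ m * 1 := by gcongr
      _ ≤ m * m ^ 2 := by gcongr; exact one_le_pow₀ m1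
      _ = m ^ 3 := by ring
  have a3 : ‖w₀ * w₁ * w₂ * w₃ * c ^ 3 * g₃‖ ≤ m ^ 3 * ‖g₃‖ := by
    simp only [norm_mul, h₀, h₁, h₂, h₃, one_mul, norm_pow]
    exact mul_le_mul_of_nonneg_right (c3.trans (one_le_pow₀ m1)) (norm_nonneg _)
  refine (norm_add_le _ _).trans ?_
  refine (add_le_add_left (norm_add_le _ _) _).trans ?_
  refine (add_le_add_left (add_le_add_left (norm_add_le _ _) _) _).trans ?_
  linarith

/-- The two norms add up to at least twice `‖u‖` and twice `‖z‖ ^ 4`. The threshold carries `max 1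
‖z‖ ^ 3` so that this factor cancels in the ring bound, uniformly in `z`. -/
theorem le_norm_sub_or_le_norm_add {z u : ℂ} (hu : 1 / 16 ≤ ‖u‖) :
    1 / 16 * max 1 ‖z‖ ^ 3 ≤ ‖z ^ 4 - u‖ ∨ 1 / 16 * max 1 ‖z‖ ^ 3 ≤ ‖z ^ 4 + u‖ := by
  have h1 : 2 * ‖u‖ ≤ ‖z ^ 4 - u‖ + ‖z ^ 4 + u‖ := by
    have := norm_sub_le (z ^ 4 + u) (z ^ 4 - u)
    rw [show z ^ 4 + u - (z ^ 4 - u) = 2 * u by ring, norm_mul, Complex.norm_ofNat] at this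
    linarith
  have h2 : 2 * ‖z‖ ^ 4 ≤ ‖z ^ 4 - u‖ + ‖z ^ 4 + u‖ := by
    have := norm_add_le (z ^ 4 + u) (z ^ 4 - u)
    rw [show z ^ 4 + u + (z ^ 4 - u) = 2 * z ^ 4 by ring, norm_mul, Complex.norm_ofNat,
      norm_pow] at this
    linarith
  by_contra! h
  rcases le_total ‖z‖ 1 with hz | hz
  · rw [max_eq_left hz] at h
    linarith [h.1, h.2]
  · rw [max_eq_right hz] at h
    have : ‖z‖ ^ 3 ≤ ‖z‖ ^ 4 := pow_le_pow_right₀ hz (by norm_num)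
    have h3 : 0 < ‖z‖ ^ 3 := by positivity
    linarith [h.1, h.2]

theorem ccwBack_iterate_four (b : Site) : ccwBack (ccwBack (ccwBack (ccwBack b))) = b := by
  obtain ⟨x, y⟩ := b
  simp only [ccwBack]
  grind

theorem ccwBack_iterate_ne (b : Site) : ccwBack b ≠ b ∧ ccwBack (ccwBack b) ≠ b ∧
    ccwBack (ccwBack (ccwBack b)) ≠ b := by
  obtain ⟨x, y⟩ := b
  simp only [ccwBack]
  grind

/-- The sites from which one step of `S_↻` enters the anticlockwise block of `b`. -/
def entrySite (b : Site) (j : Fin 4) : Site := cwBack (ccwBack^[j] b)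

/-- The flip at `b` leaves the other three phases of the ring alone and so reverses the sign of `u`.
The constant is `16 = 2 ^ 4`, from `cos φ ≥ 1 / 2`. -/
theorem ring_bound {φ : ℝ} (hφ : |φ| ≤ 1) {z : ℂ} (hz : ‖z‖ ≠ 1) {b ν : Site}
    (hν : ∀ j : ℕ, ccwBack^[j] b ≠ ν) (ω : Site → Circle) :
    ‖R φ z ω (e ν) b‖ ≤ 16 * |φ| * ∑ j, ‖R φ z ω (e ν) (entrySite b j)‖ ∨
    ‖R φ z (Function.update ω b (-ω b)) (e ν) b‖ ≤
      16 * |φ| * ∑ j, ‖R φ z (Function.update ω b (-ω b)) (e ν) (entrySite b j)‖ := by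
  have hcos : 1 / 2 ≤ Real.cos φ := by
    have := Real.one_sub_sq_div_two_le_cos (x := φ)
    have h2 : φ ^ 2 ≤ 1 := by rw [← sq_abs]; exact pow_le_one₀ (abs_nonneg _) hφ
    linarith
  have hc : ‖(Real.cos φ : ℂ)‖ ≤ 1 := by
    rw [Complex.norm_real]; exact Real.abs_cos_le_one φ
  have hσ : ‖Complex.I * (Real.sin φ : ℂ)‖ ≤ |φ| := by
    rw [norm_mul, Complex.norm_I, one_mul, Complex.norm_real]
    exact Real.abs_sin_le_abs
  have hw := fun (ω : Site → Circle) =>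
    norm_mul_ring_le hc (Circle.norm_coe (ω b)) (Circle.norm_coe (ω (ccwBack b)))
      (Circle.norm_coe (ω (ccwBack (ccwBack b))))
      (Circle.norm_coe (ω (ccwBack (ccwBack (ccwBack b)))))
      (resolvent_eq φ hz ω (hν 0)) (resolvent_eq φ hz ω (hν 1)) (resolvent_eq φ hz ω (hν 2))
      (by
        have := resolvent_eq φ hz ω (hν 3)
        rw [S_apply] at this
        simp only [Function.iterate_succ, Function.comp_apply, Function.iterate_zero, id,
          ccwBack_iterate_four] at this
        exact this)
  have key : ∀ ω' : Site → Circle, 1 / 16 * max 1 ‖z‖ ^ 3 ≤ ‖z ^ 4 - (ω' b : ℂ) *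
      (ω' (ccwBack b) * ω' (ccwBack (ccwBack b)) * ω' (ccwBack (ccwBack (ccwBack b))) *
        (Real.cos φ : ℂ) ^ 4)‖ → ‖R φ z ω' (e ν) b‖ ≤
      16 * |φ| * ∑ j, ‖R φ z ω' (e ν) (entrySite b j)‖ := by
    intro ω' h
    have h1 := (mul_le_mul_of_nonneg_left h (norm_nonneg (R φ z ω' (e ν) b))).trans (hw ω')
    have h2 : (0 : ℝ) < max 1 ‖z‖ ^ 3 := by positivity
    rw [Fin.sum_univ_four]
    change _ ≤ 16 * |φ| * (‖R φ z ω' (e ν) (cwBack b)‖ + ‖R φ z ω' (e ν) (cwBack (ccwBack b))‖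
      + ‖R φ z ω' (e ν) (cwBack (ccwBack (ccwBack b)))‖
      + ‖R φ z ω' (e ν) (cwBack (ccwBack (ccwBack (ccwBack b))))‖)
    set G := ‖R φ z ω' (e ν) (cwBack b)‖ + ‖R φ z ω' (e ν) (cwBack (ccwBack b))‖
      + ‖R φ z ω' (e ν) (cwBack (ccwBack (ccwBack b)))‖
      + ‖R φ z ω' (e ν) (cwBack (ccwBack (ccwBack (ccwBack b))))‖
    have hG : 0 ≤ G := by positivity
    have h3 : ‖R φ z ω' (e ν) b‖ * (1 / 16) * max 1 ‖z‖ ^ 3 ≤ |φ| * G * max 1 ‖z‖ ^ 3 := by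
      calc _ ≤ ‖Complex.I * (Real.sin φ : ℂ)‖ * max 1 ‖z‖ ^ 3 * G := by
            rw [mul_assoc]; exact h1
        _ ≤ |φ| * max 1 ‖z‖ ^ 3 * G := by gcongr
        _ = _ := by ring
    have := le_of_mul_le_mul_right h3 h2
    linarith
  have hu : 1 / 16 ≤ ‖(ω b : ℂ) * (ω (ccwBack b) * ω (ccwBack (ccwBack b)) *
      ω (ccwBack (ccwBack (ccwBack b))) * (Real.cos φ : ℂ) ^ 4)‖ := by
    simp only [norm_mul, Circle.norm_coe, one_mul, norm_pow, Complex.norm_real]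
    rw [Real.norm_of_nonneg (by linarith)]
    calc (1 / 16 : ℝ) = (1 / 2) ^ 4 := by norm_num
      _ ≤ _ := by gcongr
  refine (le_norm_sub_or_le_norm_add (z := z) hu).imp (key ω) fun h => key _ ?_
  obtain ⟨n1, n2, n3⟩ := ccwBack_iterate_ne b
  rw [Function.update_self, Function.update_of_ne n1, Function.update_of_ne n2,
    Function.update_of_ne n3, Circle.coe_neg, neg_mul, sub_neg_eq_add]
  exact h

/-! ### Inverse fractional moments on the circle -/

theorem circleMeasure_eq_map : circleMeasure =
    (volume : Measure (AddCircle (1 : ℝ))).map AddCircle.toCircle := by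
  have h := (UnitAddCircle.measurePreserving_mk 0).map_eq
  rw [zero_add] at h
  change Measure.map _ _ = (volume : Measure (AddCircle (1 : ℝ))) at h
  rw [← h, Measure.map_map AddCircle.continuous_toCircle.measurable
    (AddCircle.measurable_mk')]
  rw [circleMeasure]
  congr 1
  ext1 t
  rw [Function.comp_apply, AddCircle.toCircle_apply_mk, div_one]

/-- The normalized Lebesgue measure on the circle is invariant under rotations. -/
theorem measurePreserving_mul_circle (g : Circle) :
    MeasurePreserving (fun t : Circle => t * g) circleMeasure circleMeasure := by
  refine ⟨(continuous_mul_const g).measurable, ?_⟩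
  obtain ⟨a, rfl⟩ := (AddCircle.homeomorphCircle one_ne_zero).surjective g
  rw [AddCircle.homeomorphCircle_apply]
  have hm : Measurable (AddCircle.toCircle : AddCircle (1 : ℝ) → Circle) :=
    AddCircle.continuous_toCircle.measurable
  rw [circleMeasure_eq_map, Measure.map_map (continuous_mul_const _).measurable hm]
  conv_rhs => rw [← (measurePreserving_add_right (volume : Measure (AddCircle (1 : ℝ))) a).map_eq]
  rw [Measure.map_map hm (measurable_add_const a)]
  congr 1
  ext1 t
  simp only [Function.comp_apply, AddCircle.toCircle_add]

theorem setLIntegral_rpow_neg_lt_top {s : ℝ} (hs1 : s < 1) (c : ℝ) (hc0 : 0 ≤ c) (hc1 : c ≤ 1) :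
    ∫⁻ x in Set.Ioc (0 : ℝ) 1, ‖x - c‖ₑ ^ (-s) < ∞ := by
  set g : ℝ → ℝ≥0∞ := (Set.Icc (0 : ℝ) 1).indicator fun x => ‖x‖ₑ ^ (-s) with hg
  have hgm : Measurable g := (measurable_id.enorm.pow_const _).indicator measurableSet_Icc
  have hgfin : ∫⁻ x, g x < ∞ := by
    rw [hg, lintegral_indicator measurableSet_Icc, ← setLIntegral_congr Ioc_ae_eq_Icc]
    have h := (intervalIntegral.intervalIntegrable_rpow' (a := 0) (b := 1)
      (show -1 < -s by linarith)).1.hasFiniteIntegral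
    refine lt_of_le_of_lt (le_of_eq ?_) h
    refine setLIntegral_congr_fun measurableSet_Ioc fun x hx => ?_
    dsimp only
    rw [← ofReal_norm, ← ofReal_norm, Real.norm_of_nonneg hx.1.le,
      ENNReal.ofReal_rpow_of_pos hx.1, Real.norm_of_nonneg (Real.rpow_nonneg hx.1.le _)]
  have hle : ∀ x ∈ Set.Ioc (0 : ℝ) 1, ‖x - c‖ₑ ^ (-s) ≤ g (x - c) + g (c - x) := by
    intro x hx
    rcases le_total c x with h | h
    · refine le_trans (le_of_eq ?_) le_self_add
      rw [hg, Set.indicator_of_mem]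
      exact ⟨by linarith, by linarith [hx.2]⟩
    · refine le_trans (le_of_eq ?_) le_add_self
      rw [hg, Set.indicator_of_mem, ← enorm_neg, neg_sub]
      exact ⟨by linarith, by linarith [hx.1]⟩
  calc _ ≤ ∫⁻ x in Set.Ioc (0 : ℝ) 1, (g (x - c) + g (c - x)) :=
        setLIntegral_mono' measurableSet_Ioc hle
    _ ≤ ∫⁻ x, (g (x - c) + g (c - x)) := setLIntegral_le_lintegral _ _
    _ = (∫⁻ x, g (x - c)) + ∫⁻ x, g (c - x) :=
        lintegral_add_left (hgm.comp (measurable_id.sub_const c)) _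
    _ = (∫⁻ x, g x) + ∫⁻ x, g x := by
        rw [lintegral_sub_right_eq_self g c, lintegral_sub_left_eq_self g c]
    _ < ∞ := ENNReal.add_lt_top.2 ⟨hgfin, hgfin⟩

/-- Every point of the interval is within `1 / 4` of one of the zeros `0`, `1 / 2`, `1` of the sine,
and there Jordan's inequality applies. -/
theorem abs_sin_two_pi_mul_ge {x : ℝ} (h0 : 0 < x) (h1 : x ≤ 1) :
    |x - 0| ≤ |Real.sin (2 * Real.pi * x)| ∨ |x - 1 / 2| ≤ |Real.sin (2 * Real.pi * x)| ∨
      |x - 1| ≤ |Real.sin (2 * Real.pi * x)| := by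
  have key : ∀ y : ℝ, |y| ≤ 1 / 4 → |y| ≤ |Real.sin (2 * Real.pi * y)| := by
    intro y hy
    have hpi := Real.pi_pos
    have h := Real.mul_le_sin (x := 2 * Real.pi * |y|) (by positivity) (by nlinarith)
    have h2 : 2 / Real.pi * (2 * Real.pi * |y|) = 4 * |y| := by field_simp; ring
    rw [h2] at h
    have h3 : Real.sin (2 * Real.pi * |y|) ≤ |Real.sin (2 * Real.pi * y)| := by
      rcases abs_cases y with ⟨h, _⟩ | ⟨h, _⟩
      · rw [h]; exact le_abs_self _
      · rw [h, mul_neg, Real.sin_neg]; exact neg_le_abs _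
    linarith [abs_nonneg y]
  rcases le_total x (1 / 4) with h | h
  · left
    rw [sub_zero]
    exact key x (by rwa [abs_of_pos h0])
  rcases le_total x (3 / 4) with h' | h'
  · right; left
    have := key (x - 1 / 2) (abs_le.2 ⟨by linarith, by linarith⟩)
    rwa [show 2 * Real.pi * (x - 1 / 2) = 2 * Real.pi * x - Real.pi by ring, Real.sin_sub_pi,
      abs_neg] at this
  · right; right
    have := key (x - 1) (abs_le.2 ⟨by linarith, by linarith⟩)
    rwa [show 2 * Real.pi * (x - 1) = 2 * Real.pi * x - 2 * Real.pi by ring,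
      Real.sin_sub_two_pi] at this

theorem measurable_circle_im : Measurable fun t : Circle => (t : ℂ).im := by
  have : Continuous fun t : Circle => (t : ℂ) := by fun_prop
  exact (Complex.continuous_im.comp this).measurable

theorem lintegral_abs_im_rpow_lt_top {s : ℝ} (hs0 : 0 < s) (hs1 : s < 1) :
    ∫⁻ t : Circle, ‖(t : ℂ).im‖ₑ ^ (-s) ∂circleMeasure < ∞ := by
  have him : ∀ x : ℝ, (Circle.exp (2 * Real.pi * x) : ℂ).im = Real.sin (2 * Real.pi * x) := by
    intro x
    rw [Circle.coe_exp, Complex.exp_ofReal_mul_I_im]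
  rw [circleMeasure, lintegral_map (measurable_circle_im.enorm.pow_const _)
    (show Measurable fun t : ℝ => Circle.exp (2 * Real.pi * t) from
      (Circle.exp.continuous.comp (continuous_const.mul continuous_id)).measurable)]
  simp only [him]
  have hmono : ∀ {a b : ℝ}, |a| ≤ |b| → ‖b‖ₑ ^ (-s) ≤ ‖a‖ₑ ^ (-s) := by
    intro a b h
    rw [ENNReal.rpow_neg, ENNReal.rpow_neg, ENNReal.inv_le_inv]
    refine ENNReal.rpow_le_rpow ?_ hs0.le
    rw [← ofReal_norm, ← ofReal_norm]
    exact ENNReal.ofReal_le_ofReal h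
  have hm : ∀ c : ℝ, Measurable fun x : ℝ => ‖x - c‖ₑ ^ (-s) := fun c =>
    (measurable_id.sub_const c).enorm.pow_const _
  calc _ ≤ ∫⁻ x in Set.Ioc (0 : ℝ) 1,
        (‖x - 0‖ₑ ^ (-s) + (‖x - 1 / 2‖ₑ ^ (-s) + ‖x - 1‖ₑ ^ (-s))) := by
        refine setLIntegral_mono' measurableSet_Ioc fun x hx => ?_
        rcases abs_sin_two_pi_mul_ge hx.1 hx.2 with h | h | h
        · exact (hmono h).trans le_self_add
        · exact (hmono h).trans (le_self_add.trans le_add_self)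
        · exact (hmono h).trans (le_add_self.trans le_add_self)
    _ = _ := by rw [lintegral_add_left (hm 0), lintegral_add_left (hm _)]
    _ < ∞ := by
        simp only [ENNReal.add_lt_top]
        exact ⟨setLIntegral_rpow_neg_lt_top hs1 _ le_rfl zero_le_one,
          setLIntegral_rpow_neg_lt_top hs1 _ (by norm_num) (by norm_num),
          setLIntegral_rpow_neg_lt_top hs1 _ zero_le_one le_rfl⟩

/-- Multiplying `p * t - q` by the conjugate of `q`, or of `p * t`, produces this imaginary part up
to sign, since the remaining term is real. -/
theorem sq_im_le_normSq_sub (p q : ℂ) (t : Circle) :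
    ((t : ℂ) * (p * (starRingEnd ℂ) q)).im ^ 2 ≤ ‖q‖ ^ 2 * ‖p * t - q‖ ^ 2 ∧
    ((t : ℂ) * (p * (starRingEnd ℂ) q)).im ^ 2 ≤ ‖p‖ ^ 2 * ‖p * t - q‖ ^ 2 := by
  have ht : (t : ℂ).re ^ 2 + (t : ℂ).im ^ 2 = 1 := by
    have := Circle.normSq_coe t
    rw [Complex.normSq_apply] at this
    linarith
  constructor
  · have : ((t : ℂ) * (p * (starRingEnd ℂ) q)).im = ((starRingEnd ℂ) q * (p * t - q)).im := by
      simp; ring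
    rw [this, ← mul_pow, ← Complex.norm_conj q, ← norm_mul, ← sq_abs]
    gcongr
    exact Complex.abs_im_le_norm _
  · have : ((t : ℂ) * (p * (starRingEnd ℂ) q)).im
        = -((starRingEnd ℂ) (p * t) * q).im := by
      simp; ring
    have h2 : ((starRingEnd ℂ) (p * t) * q).im
        = -((starRingEnd ℂ) (p * t) * (p * t - q)).im := by
      simp; ring
    have hp : ‖p‖ = ‖(starRingEnd ℂ) (p * t)‖ := by
      rw [Complex.norm_conj, norm_mul, Circle.norm_coe, mul_one]
    rw [this, h2, neg_neg, ← mul_pow, hp, ← norm_mul, ← sq_abs]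
    gcongr
    exact Complex.abs_im_le_norm _

/-- With `g` the direction of `p` times the conjugate of `q`, `max ‖p‖ ‖q‖ * |Im (t * g)| ≤ ‖p * t -
q‖`. If that product vanishes, `‖p * t - q‖` is a constant at least `1 / 2` and any rotation serves.
-/
theorem exists_rotation_abs_im_le (p q : ℂ) (h : 1 / 2 ≤ max ‖p‖ ‖q‖) :
    ∃ g : Circle, ∀ t : Circle, |((t * g : Circle) : ℂ).im| ≤ 2 * ‖p * t - q‖ := by
  have trivial_case : ∀ t : Circle, p * (starRingEnd ℂ) q = 0 →
      |((t * 1 : Circle) : ℂ).im| ≤ 2 * ‖p * t - q‖ := by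
    intro t h0
    have h1 : |((t * 1 : Circle) : ℂ).im| ≤ 1 :=
      (Complex.abs_im_le_norm _).trans (Circle.norm_coe _).le
    refine h1.trans ?_
    rcases mul_eq_zero.1 h0 with hp | hq
    · rw [hp, norm_zero, max_eq_right (norm_nonneg _)] at h
      rw [hp, zero_mul, zero_sub, norm_neg]; linarith
    · rw [map_eq_zero] at hq
      rw [hq, norm_zero, max_eq_left (norm_nonneg _)] at h
      rw [hq, sub_zero, norm_mul, Circle.norm_coe, mul_one]; linarith
  by_cases h0 : p * (starRingEnd ℂ) q = 0
  · exact ⟨1, fun t => trivial_case t h0⟩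
  · have hp : 0 < ‖p‖ := norm_pos_iff.2 (left_ne_zero_of_mul h0)
    have hq : 0 < ‖q‖ := by
      rw [← Complex.norm_conj]; exact norm_pos_iff.2 (right_ne_zero_of_mul h0)
    refine ⟨Circle.exp (p * (starRingEnd ℂ) q).arg, fun t => ?_⟩
    set g := Circle.exp (p * (starRingEnd ℂ) q).arg with hg
    have hpq : p * (starRingEnd ℂ) q = ((‖p‖ * ‖q‖ : ℝ) : ℂ) * g := by
      have := Complex.norm_mul_exp_arg_mul_I (p * (starRingEnd ℂ) q)
      rw [norm_mul, Complex.norm_conj] at this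
      rw [hg, Circle.coe_exp, this]
    have him : ((t : ℂ) * (p * (starRingEnd ℂ) q)).im
        = ‖p‖ * ‖q‖ * ((t * g : Circle) : ℂ).im := by
      rw [hpq, mul_left_comm, Complex.im_ofReal_mul, Circle.coe_mul]
    obtain ⟨k1, k2⟩ := sq_im_le_normSq_sub p q t
    rw [him] at k1 k2
    set y := ((t * g : Circle) : ℂ).im
    set N := ‖p * t - q‖ with hN
    have hN0 : 0 ≤ N := norm_nonneg _
    have c1 : ‖p‖ * |y| ≤ N := by
      have : (‖p‖ * |y|) ^ 2 ≤ N ^ 2 := by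
        rw [mul_pow, sq_abs]
        refine le_of_mul_le_mul_left ?_ (pow_pos hq 2)
        calc _ = _ := by ring
          _ ≤ _ := k1
      exact abs_le_of_sq_le_sq' this hN0 |>.2
    have c2 : ‖q‖ * |y| ≤ N := by
      have : (‖q‖ * |y|) ^ 2 ≤ N ^ 2 := by
        rw [mul_pow, sq_abs]
        refine le_of_mul_le_mul_left ?_ (pow_pos hp 2)
        calc _ = _ := by ring
          _ ≤ _ := k2
      exact abs_le_of_sq_le_sq' this hN0 |>.2
    rcases le_max_iff.1 h with h' | h'
    · nlinarith [abs_nonneg y]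
    · nlinarith [abs_nonneg y]

/-- Uniform bound for the fractional inverse moments of `p t - q` over the circle. -/
theorem exists_lintegral_rpow_neg_le {s : ℝ} (hs0 : 0 < s) (hs1 : s < 1) :
    ∃ K : NNReal, ∀ p q : ℂ, 1 / 2 ≤ max ‖p‖ ‖q‖ →
      ∫⁻ t : Circle, ‖p * t - q‖ₑ ^ (-s) ∂circleMeasure ≤ K := by
  have hfin : 2 ^ s * ∫⁻ t : Circle, ‖(t : ℂ).im‖ₑ ^ (-s) ∂circleMeasure < ∞ :=
    ENNReal.mul_lt_top (ENNReal.rpow_lt_top_of_nonneg hs0.le (by norm_num))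
      (lintegral_abs_im_rpow_lt_top hs0 hs1)
  refine ⟨(2 ^ s * ∫⁻ t : Circle, ‖(t : ℂ).im‖ₑ ^ (-s) ∂circleMeasure).toNNReal,
    fun p q h => ?_⟩
  rw [ENNReal.coe_toNNReal hfin.ne]
  obtain ⟨g, hg⟩ := exists_rotation_abs_im_le p q h
  have hmeas : Measurable fun t : Circle => ‖(t : ℂ).im‖ₑ ^ (-s) :=
    measurable_circle_im.enorm.pow_const _
  rw [← (measurePreserving_mul_circle g).lintegral_comp hmeas, ← lintegral_const_mul]
  · refine lintegral_mono fun t => ?_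
    have h1 : ‖((t * g : Circle) : ℂ).im‖ₑ ≤ 2 * ‖p * t - q‖ₑ := by
      rw [← ofReal_norm, ← ofReal_norm, Real.norm_eq_abs]
      rw [show (2 : ℝ≥0∞) = ENNReal.ofReal 2 by simp, ← ENNReal.ofReal_mul (by norm_num)]
      exact ENNReal.ofReal_le_ofReal (hg t)
    have h2 : ‖((t * g : Circle) : ℂ).im‖ₑ / 2 ≤ ‖p * t - q‖ₑ := by
      rw [ENNReal.div_le_iff (by norm_num) (by norm_num), mul_comm _ (2 : ℝ≥0∞)]
      exact h1
    calc ‖p * t - q‖ₑ ^ (-s) ≤ (‖((t * g : Circle) : ℂ).im‖ₑ / 2) ^ (-s) := by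
          rw [ENNReal.rpow_neg, ENNReal.rpow_neg, ENNReal.inv_le_inv]
          exact ENNReal.rpow_le_rpow h2 hs0.le
      _ = 2 ^ s * ‖((t * g : Circle) : ℂ).im‖ₑ ^ (-s) := by
          rw [ENNReal.rpow_neg, ENNReal.div_rpow_of_nonneg _ _ hs0.le, ENNReal.rpow_neg,
            ENNReal.inv_div (Or.inl (by simp)) (Or.inl (by simp)), div_eq_mul_inv]
  · exact hmeas.comp (continuous_mul_const g).measurable

/-! ### Resampling and flipping one phase -/

theorem measurable_update_prod (b : Site) :
    Measurable fun p : (Site → Circle) × Circle => Function.update p.1 b p.2 := by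
  refine measurable_pi_iff.2 fun i => ?_
  rcases eq_or_ne i b with rfl | h
  · simpa only [Function.update_self] using measurable_snd
  · simp only [Function.update_of_ne h]
    exact (measurable_pi_apply i).comp measurable_fst

/-- Resampling one phase does not change the law of the phases. -/
theorem measurePreserving_update (b : Site) :
    MeasurePreserving (fun p : (Site → Circle) × Circle => Function.update p.1 b p.2)
      (P.prod circleMeasure) P := by
  refine ⟨measurable_update_prod b, ?_⟩
  unfold P
  refine Measure.eq_infinitePi _ fun I T hT => ?_
  rw [Measure.map_apply (measurable_update_prod b)
    (MeasurableSet.pi I.countable_toSet fun i _ => hT i)]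
  -- A cylinder pulls back to a cylinder not involving `b` times a condition on `t`, vacuous when `b
  -- ∉ I`.
  have hpre : (fun p : (Site → Circle) × Circle => Function.update p.1 b p.2) ⁻¹'
      (Set.pi (I : Set Site) T) =
      (Set.pi ((I.erase b : Finset Site) : Set Site) T) ×ˢ {t | b ∈ I → t ∈ T b} := by
    ext ⟨ω, t⟩
    simp only [Set.mem_preimage, Set.mem_pi, Finset.mem_coe, Set.mem_prod, Finset.mem_erase,
      Set.mem_ofPred_eq]
    constructor
    · intro h
      refine ⟨fun i hi => ?_, fun hb => ?_⟩
      · simpa only [Function.update_of_ne hi.1] using h i hi.2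
      · simpa only [Function.update_self] using h b hb
    · rintro ⟨h1, h2⟩ i hi
      rcases eq_or_ne i b with rfl | hib
      · rw [Function.update_self]; exact h2 hi
      · rw [Function.update_of_ne hib]; exact h1 i ⟨hib, hi⟩
  rw [hpre, Measure.prod_prod, Measure.infinitePi_pi _ fun i _ => hT i]
  by_cases hb : b ∈ I
  · simp only [hb, true_imp_iff, Set.ofPred_mem_eq]
    exact Finset.prod_erase_mul I (fun i => circleMeasure (T i)) hb
  · simp [hb]

theorem lintegral_update (b : Site) {f : (Site → Circle) → ℝ≥0∞} (hf : Measurable f) :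
    ∫⁻ ω, ∫⁻ t, f (Function.update ω b t) ∂circleMeasure ∂P = ∫⁻ ω, f ω ∂P := by
  rw [← (measurePreserving_update b).lintegral_comp hf,
    lintegral_prod (fun p => f (Function.update p.1 b p.2))
      (hf.comp (measurable_update_prod b)).aemeasurable]

/-- After resampling the phase at `b`, the flip is a rotation by `-1` in the new variable alone. -/
theorem lintegral_update_neg (b : Site) {f : (Site → Circle) → ℝ≥0∞} (hf : Measurable f) :
    ∫⁻ ω, f (Function.update ω b (-ω b)) ∂P = ∫⁻ ω, f ω ∂P := by
  have hneg : ∀ t : Circle, t * (-1) = -t := fun t => by rw [mul_neg, mul_one]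
  have hm : Measurable fun ω : Site → Circle => Function.update ω b (-ω b) := by
    refine measurable_pi_iff.2 fun i => ?_
    rcases eq_or_ne i b with rfl | h
    · simp only [Function.update_self]
      have h := (measurePreserving_mul_circle (-1)).measurable
      simp only [hneg] at h
      exact h.comp (measurable_pi_apply i)
    · simpa only [Function.update_of_ne h] using measurable_pi_apply i
  rw [← lintegral_update b (f := fun ω => f (Function.update ω b (-ω b))) (hf.comp hm),
    ← lintegral_update b hf]
  refine lintegral_congr fun ω => ?_
  have hmt : Measurable fun t : Circle => f (Function.update ω b t) :=
    hf.comp ((measurable_update_prod b).comp measurable_prodMk_left)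
  rw [← (measurePreserving_mul_circle (-1)).lintegral_comp hmt]
  refine lintegral_congr fun t => ?_
  rw [Function.update_idem, Function.update_self, hneg]

/-! ### The moment estimate for one block -/

theorem sum_rpow_le_sum_rpow {s : ℝ} (hs0 : 0 < s) (hs1 : s ≤ 1) {ι : Type*} (I : Finset ι)
    (f : ι → ℝ≥0∞) : (∑ i ∈ I, f i) ^ s ≤ ∑ i ∈ I, f i ^ s := by
  classical
  induction I using Finset.induction_on with
  | empty => simp [hs0]
  | insert i I hi ih =>
    rw [Finset.sum_insert hi, Finset.sum_insert hi]
    exact (ENNReal.rpow_add_le_add_rpow _ _ hs0.le hs1).trans (by gcongr)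

/-- Averaging over the phase at `b` controls the resolvent at `b` by its value for any fixed
phase. -/
theorem lintegral_resolvent_update_le {s : ℝ} (hs0 : 0 < s) {K : NNReal}
    (hK : ∀ p q : ℂ, 1 / 2 ≤ max ‖p‖ ‖q‖ →
      ∫⁻ t : Circle, ‖p * t - q‖ₑ ^ (-s) ∂circleMeasure ≤ K)
    (φ : ℝ) {z : ℂ} (hz : ‖z‖ ≠ 1) (ω : Site → Circle) {b ν : Site} (h : b ≠ ν) :
    ∫⁻ t, ‖R φ z (Function.update ω b t) (e ν) b‖ₑ ^ s ∂circleMeasure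
      ≤ K * ‖R φ z ω (e ν) b‖ₑ ^ s := by
  by_cases h0 : R φ z ω (e ν) b = 0
  · have hzero : ∀ t, R φ z (Function.update ω b t) (e ν) b = 0 := by
      intro t
      have := resolvent_update φ hz (Function.update ω b t) h (ω b)
      rw [Function.update_idem, Function.update_eq_self, h0, zero_mul] at this
      exact (mul_eq_zero.1 this.symm).resolve_left (Circle.coe_ne_zero _)
    simp [hzero, hs0]
  · set d := z * R φ z ω (e b) b with hd
    -- The numbers `1 + d` and `d` differ by `1`, so they cannot both have modulus below `1 / 2`.
    have hpq : 1 / 2 ≤ max ‖1 + d‖ ‖d * ω b‖ := by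
      rw [norm_mul, Circle.norm_coe, mul_one]
      have := norm_sub_le (1 + d) d
      rw [add_sub_cancel_right, norm_one] at this
      rcases le_total (1 / 2) ‖d‖ with h1 | h1
      · exact h1.trans (le_max_right _ _)
      · exact le_trans (by linarith) (le_max_left _ _)
    rw [mul_comm]
    refine le_trans (le_of_eq ?_) (mul_le_mul_right (hK _ _ hpq) (‖R φ z ω (e ν) b‖ₑ ^ s))
    rw [← lintegral_const_mul' _ _ (ENNReal.rpow_ne_top_of_nonneg hs0.le enorm_ne_top)]
    refine lintegral_congr fun t => ?_
    have h1 := resolvent_update φ hz ω h t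
    rw [← hd] at h1
    have hne : R φ z (Function.update ω b t) (e ν) b * ((1 + d) * t - d * ω b) ≠ 0 := by
      rw [h1]; exact mul_ne_zero (Circle.coe_ne_zero _) h0
    have h2 : ‖R φ z ω (e ν) b‖ₑ = ‖R φ z (Function.update ω b t) (e ν) b‖ₑ *
        ‖(1 + d) * t - d * ω b‖ₑ := by
      rw [← enorm_mul, h1, enorm_mul]
      rw [← ofReal_norm (t : ℂ), Circle.norm_coe, ENNReal.ofReal_one, one_mul]
    have h3 : ‖(1 + d) * t - d * ω b‖ₑ ≠ 0 := by
      simpa using right_ne_zero_of_mul hne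
    rw [h2, ENNReal.mul_rpow_of_nonneg _ _ hs0.le, mul_assoc,
      ← ENNReal.rpow_add _ _ h3 enorm_ne_top]
    simp

/-- Which of the two phases is good depends on `ω`; adding both alternatives avoids the choice and
costs the factor `2`, since the flip preserves the measure. -/
theorem lintegral_resolvent_le {s : ℝ} (hs0 : 0 < s) (hs1 : s < 1) {K : NNReal}
    (hK : ∀ p q : ℂ, 1 / 2 ≤ max ‖p‖ ‖q‖ →
      ∫⁻ t : Circle, ‖p * t - q‖ₑ ^ (-s) ∂circleMeasure ≤ K)
    {φ : ℝ} (hφ : |φ| ≤ 1) {z : ℂ} (hz : ‖z‖ ≠ 1) {b ν : Site}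
    (hν : ∀ j : ℕ, ccwBack^[j] b ≠ ν) :
    ∫⁻ ω, ‖R φ z ω (e ν) b‖ₑ ^ s ∂P ≤ 2 * K * ENNReal.ofReal (16 * |φ|) ^ s *
      ∑ j, ∫⁻ ω, ‖R φ z ω (e ν) (entrySite b j)‖ₑ ^ s ∂P := by
  have hm : ∀ β, Measurable fun ω => ‖R φ z ω (e ν) β‖ₑ ^ s := fun β =>
    (continuous_resolvent_apply φ hz β ν).measurable.enorm.pow_const _
  set G : (Site → Circle) → ℝ≥0∞ := fun ω => ∑ j, ‖R φ z ω (e ν) (entrySite b j)‖ₑ ^ s with hG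
  have hGm : Measurable G := Finset.measurable_sum _ fun j _ => hm _
  set C : ℝ≥0∞ := K * ENNReal.ofReal (16 * |φ|) ^ s with hC
  have step : ∀ ω, ‖R φ z ω (e ν) b‖ ≤ 16 * |φ| * ∑ j, ‖R φ z ω (e ν) (entrySite b j)‖ →
      K * ‖R φ z ω (e ν) b‖ₑ ^ s ≤ C * G ω := by
    intro ω h
    rw [hC, mul_assoc]
    gcongr
    have h1 : ‖R φ z ω (e ν) b‖ₑ ≤ ENNReal.ofReal (16 * |φ|) *
        ∑ j, ‖R φ z ω (e ν) (entrySite b j)‖ₑ := by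
      rw [← ofReal_norm]
      refine (ENNReal.ofReal_le_ofReal h).trans (le_of_eq ?_)
      rw [ENNReal.ofReal_mul (by positivity),
        ENNReal.ofReal_sum_of_nonneg fun _ _ => norm_nonneg _]
      simp only [ofReal_norm]
    refine (ENNReal.rpow_le_rpow h1 hs0.le).trans ?_
    rw [ENNReal.mul_rpow_of_nonneg _ _ hs0.le]
    gcongr
    exact sum_rpow_le_sum_rpow hs0 hs1.le _ _
  have hpt : ∀ ω, ∫⁻ t, ‖R φ z (Function.update ω b t) (e ν) b‖ₑ ^ s ∂circleMeasure
      ≤ C * G ω + C * G (Function.update ω b (-ω b)) := by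
    intro ω
    rcases ring_bound hφ hz hν ω with h | h
    · exact ((lintegral_resolvent_update_le hs0 hK φ hz ω (hν 0)).trans (step ω h)).trans
        le_self_add
    · have h1 := lintegral_resolvent_update_le hs0 hK φ hz (Function.update ω b (-ω b)) (hν 0)
      simp only [Function.iterate_zero, id, Function.update_idem] at h1
      exact (h1.trans (step _ h)).trans le_add_self
  have hCG : Measurable fun ω => C * G ω := hGm.const_mul C
  calc ∫⁻ ω, ‖R φ z ω (e ν) b‖ₑ ^ s ∂P
      = ∫⁻ ω, ∫⁻ t, ‖R φ z (Function.update ω b t) (e ν) b‖ₑ ^ s ∂circleMeasure ∂P :=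
        (lintegral_update b (hm b)).symm
    _ ≤ ∫⁻ ω, (C * G ω + C * G (Function.update ω b (-ω b))) ∂P := lintegral_mono hpt
    _ = ∫⁻ ω, C * G ω ∂P + ∫⁻ ω, C * G (Function.update ω b (-ω b)) ∂P :=
        lintegral_add_left hCG _
    _ = ∫⁻ ω, C * G ω ∂P + ∫⁻ ω, C * G ω ∂P := by rw [lintegral_update_neg b hCG]
    _ = 2 * C * ∫⁻ ω, G ω ∂P := by rw [lintegral_const_mul C hGm]; ring
    _ = _ := by
        rw [hG, lintegral_finsetSum _ fun j _ => hm _, hC, ← mul_assoc 2]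

/-- The fractional moments at a site of an anticlockwise block off the source are dominated by
those at the sites entering the block. -/
theorem exists_fracMoment_le {s : ℝ} (hs0 : 0 < s) (hs1 : s < 1) :
    ∃ φ₀ : ℝ, 0 < φ₀ ∧ ∀ φ : ℝ, |φ| < φ₀ → ∀ z : ℂ, ‖z‖ ≠ 1 → ∀ b ν : Site,
      (∀ j : ℕ, ccwBack^[j] b ≠ ν) →
      fracMoment s φ z b ν ≤ 1 / 8 * ∑ j, fracMoment s φ z (entrySite b j) ν := by
  obtain ⟨K, hK⟩ := exists_lintegral_rpow_neg_le hs0 hs1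
  -- Chosen so that `2 * K * ε ^ s ≤ 1 / 8`; `K + 1` guards against `K = 0`.
  set ε : ℝ := (1 / (16 * (K + 1))) ^ (1 / s) with hε
  have hK1 : (0 : ℝ) < 16 * (K + 1) := by positivity
  have hε0 : 0 < ε := Real.rpow_pos_of_pos (by positivity) _
  have hεs : ε ^ s = 1 / (16 * (K + 1)) := by
    rw [hε, ← Real.rpow_mul (by positivity), one_div_mul_cancel hs0.ne', Real.rpow_one]
  refine ⟨min 1 (ε / 16), by positivity, fun φ hφ z hz b ν hν => ?_⟩
  have h1 : |φ| ≤ 1 := hφ.le.trans (min_le_left _ _)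
  have h2 : 16 * |φ| ≤ ε := by linarith [hφ.le.trans (min_le_right _ _)]
  have h := lintegral_resolvent_le hs0 hs1 hK h1 hz hν
  simp only [← ofReal_fracMoment hs0 φ hz] at h
  rw [← ENNReal.ofReal_sum_of_nonneg fun _ _ => fracMoment_nonneg _ _ _ _ _,
    ENNReal.ofReal_rpow_of_nonneg (by positivity) hs0.le, ← ENNReal.ofReal_coe_nnreal,
    show (2 : ℝ≥0∞) = ENNReal.ofReal 2 by simp, ← ENNReal.ofReal_mul (by norm_num),
    ← ENNReal.ofReal_mul (by positivity), ← ENNReal.ofReal_mul (by positivity)] at h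
  have hsum : 0 ≤ ∑ j, fracMoment s φ z (entrySite b j) ν :=
    Finset.sum_nonneg fun _ _ => fracMoment_nonneg _ _ _ _ _
  rw [ENNReal.ofReal_le_ofReal_iff (by positivity)] at h
  refine h.trans (mul_le_mul_of_nonneg_right ?_ hsum)
  calc 2 * (K : ℝ) * (16 * |φ|) ^ s ≤ 2 * K * ε ^ s := by gcongr
    _ = 2 * K * (1 / (16 * (K + 1))) := by rw [hεs]
    _ ≤ 1 / 8 := by
        rw [mul_one_div, div_le_iff₀ hK1]
        linarith

/-! ### Geometry of the box -/

theorem mem_shift_box (L : ℕ × ℕ) (v α : Site) : α ∈ shift (box L) v ↔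
    (-2 * (L.1 : ℤ) + v.1 ≤ α.1 ∧ α.1 ≤ 2 * (L.1 : ℤ) - 1 + v.1) ∧
      (-2 * (L.2 : ℤ) + 2 + v.2 ≤ α.2 ∧ α.2 ≤ 2 * (L.2 : ℤ) + 1 + v.2) := by
  constructor
  · rintro ⟨β, ⟨⟨h1, h2⟩, h3, h4⟩, rfl⟩
    simp only [Prod.fst_add, Prod.snd_add]
    exact ⟨⟨by linarith, by linarith⟩, by linarith, by linarith⟩
  · rintro ⟨⟨h1, h2⟩, h3, h4⟩
    refine ⟨α - v, ⟨⟨?_, ?_⟩, ?_, ?_⟩, (sub_add_cancel α v).symm⟩ <;>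
      simp only [Prod.fst_sub, Prod.snd_sub] <;> linarith

theorem finite_shift_box (L : ℕ × ℕ) (v : Site) : (shift (box L) v).Finite := by
  refine ((Set.finite_Icc (-2 * (L.1 : ℤ) + v.1) (2 * (L.1 : ℤ) - 1 + v.1)).prod
    (Set.finite_Icc (-2 * (L.2 : ℤ) + 2 + v.2) (2 * (L.2 : ℤ) + 1 + v.2))).subset ?_
  intro α hα
  exact (mem_shift_box L v α).1 hα

theorem self_mem_shift_box {L : ℕ × ℕ} (h1 : 0 < L.1) (h2 : 0 < L.2) (μ : Site) :
    μ ∈ shift (box L) (blockBase μ) := by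
  rw [mem_shift_box]
  simp only [blockBase]
  omega

/-- The box is a union of anticlockwise blocks. -/
theorem ccwBack_mem_shift_box {L : ℕ × ℕ} {μ b : Site} (h : b ∈ shift (box L) (blockBase μ)) :
    ccwBack b ∈ shift (box L) (blockBase μ) := by
  rw [mem_shift_box] at h ⊢
  obtain ⟨x, y⟩ := b
  simp only [blockBase, ccwBack] at h ⊢
  split_ifs <;> dsimp only <;> omega

theorem ccwBack_iterate_mem_shift_box {L : ℕ × ℕ} {μ b : Site}
    (h : b ∈ shift (box L) (blockBase μ)) (j : ℕ) :
    ccwBack^[j] b ∈ shift (box L) (blockBase μ) := by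
  induction j with
  | zero => exact h
  | succ j ih =>
    rw [Function.iterate_succ_apply']
    exact ccwBack_mem_shift_box ih

theorem supNorm_eq_one_iff (v : Site) : supNorm v = 1 ↔
    (|v.1| ≤ 1 ∧ |v.2| ≤ 1) ∧ (|v.1| = 1 ∨ |v.2| = 1) := by
  unfold supNorm
  omega

theorem cwBack_eq_add (b : Site) : ∃ v : Site, cwBack b = b + v ∧
    (v = (1, 0) ∨ v = (-1, 0) ∨ v = (0, 1) ∨ v = (0, -1)) := by
  obtain ⟨x, y⟩ := b
  simp only [cwBack]
  split_ifs
  · exact ⟨(-1, 0), by simp [sub_eq_add_neg], by simp⟩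
  · exact ⟨(0, 1), by simp, by simp⟩
  · exact ⟨(0, -1), by simp [sub_eq_add_neg], by simp⟩
  · exact ⟨(1, 0), by simp, by simp⟩

theorem mem_nbhd_bdry_of_neighbour {A : Set Site} {g α b w v : Site} (hα : α ∉ A) (hb : b ∈ A)
    (hv : supNorm v = 1) (hbv : b = α + v) (hw : supNorm w = 1) (hgw : g = α + w) :
    g ∈ nbhd (bdry Aᶜ) :=
  ⟨α, ⟨hα, fun h => h.2 v hv (hbv ▸ hb)⟩, w, hw, hgw⟩

/-- Since `nbhd` does not allow the zero shift, a second boundary site next to `cwBack b` is needed.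
Moving one step sideways from it gives a diagonal neighbour of `b`, which is outside because it lies
beyond the same face. -/
theorem cwBack_mem_nbhd_bdry {L : ℕ × ℕ} {v b : Site} (hb : b ∈ shift (box L) v)
    (hg : cwBack b ∉ shift (box L) v) : cwBack b ∈ nbhd (bdry (shift (box L) v)ᶜ) := by
  obtain ⟨u, hu, h⟩ := cwBack_eq_add b
  rw [hu] at hg ⊢
  have hb' := (mem_shift_box L v b).1 hb
  rcases h with rfl | rfl | rfl | rfl
  · refine mem_nbhd_bdry_of_neighbour (α := b + (1, 1)) (v := (-1, -1)) (w := (0, -1)) ?_ hb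
      (by simp [supNorm]) (by ext <;> simp) (by simp [supNorm]) (by ext <;> simp)
    rw [mem_shift_box] at hg ⊢
    simp only [Prod.fst_add, Prod.snd_add] at hg ⊢
    omega
  · refine mem_nbhd_bdry_of_neighbour (α := b + (-1, 1)) (v := (1, -1)) (w := (0, -1)) ?_ hb
      (by simp [supNorm]) (by ext <;> simp) (by simp [supNorm]) (by ext <;> simp)
    rw [mem_shift_box] at hg ⊢
    simp only [Prod.fst_add, Prod.snd_add] at hg ⊢
    omega
  · refine mem_nbhd_bdry_of_neighbour (α := b + (1, 1)) (v := (-1, -1)) (w := (-1, 0)) ?_ hb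
      (by simp [supNorm]) (by ext <;> simp) (by simp [supNorm]) (by ext <;> simp)
    rw [mem_shift_box] at hg ⊢
    simp only [Prod.fst_add, Prod.snd_add] at hg ⊢
    omega
  · refine mem_nbhd_bdry_of_neighbour (α := b + (1, -1)) (v := (-1, 1)) (w := (-1, 0)) ?_ hb
      (by simp [supNorm]) (by ext <;> simp) (by simp [supNorm]) (by ext <;> simp)
    rw [mem_shift_box] at hg ⊢
    simp only [Prod.fst_add, Prod.snd_add] at hg ⊢
    omega

theorem finite_supNorm_eq_one : {v : Site | supNorm v = 1}.Finite := by
  refine ((Set.finite_Icc (-1 : ℤ) 1).prod (Set.finite_Icc (-1 : ℤ) 1)).subset fun v hv => ?_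
  have h := ((supNorm_eq_one_iff v).1 hv).1
  exact ⟨abs_le.1 h.1, abs_le.1 h.2⟩

theorem nbhd_finite {A : Set Site} (hA : A.Finite) : (nbhd A).Finite := by
  refine (hA.image2 (fun α v => α + v) finite_supNorm_eq_one).subset ?_
  rintro β ⟨α, hα, v, hv, rfl⟩
  exact ⟨α, hα, v, hv, rfl⟩

theorem bdry_compl_subset (A : Set Site) : bdry Aᶜ ⊆ nbhd A := by
  rintro α ⟨h1, h2⟩
  simp only [latticeInterior, Set.mem_ofPred_eq, not_and, not_forall] at h2
  obtain ⟨v, hv, h⟩ := h2 h1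
  refine ⟨α + v, not_not.1 h, -v, ?_, by simp⟩
  simpa [supNorm] using hv

theorem finite_nbhd_bdry_compl {A : Set Site} (hA : A.Finite) : (nbhd (bdry Aᶜ)).Finite :=
  nbhd_finite ((nbhd_finite hA).subset (bdry_compl_subset A))

theorem nonempty_nbhd_bdry_shift_box {L : ℕ × ℕ} (h1 : 0 < L.1) (h2 : 0 < L.2) (v : Site) :
    (nbhd (bdry (shift (box L) v)ᶜ)).Nonempty := by
  -- A site just beyond the right face; height `2` is within range because `L.2 ≥ 1`.
  refine ⟨_, mem_nbhd_bdry_of_neighbour (α := (2 * (L.1 : ℤ) + v.1, 2 + v.2)) (v := (-1, 0))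
    (w := (1, 0)) (b := (2 * (L.1 : ℤ) + v.1, 2 + v.2) + (-1, 0)) ?_ ?_ (by simp [supNorm]) rfl
    (by simp [supNorm]) rfl⟩
  · rw [mem_shift_box]
    dsimp only
    omega
  · rw [mem_shift_box]
    simp only [Prod.fst_add, Prod.snd_add]
    omega

/-! ### Maximum principle and conclusion -/

/-- A discrete maximum principle: a nonnegative function which on `A` is at most half of its
maximum over `A ∪ B` is on `A` at most half of its maximum over `B`. -/
theorem le_half_of_submean {f : Site → ℝ} {A B : Set Site} (hA : A.Finite)
    (hf : ∀ b ∈ A, ∀ M : ℝ, (∀ g ∈ A ∪ B, f g ≤ M) → f b ≤ 1 / 2 * M)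
    {m : ℝ} (hm : ∀ β ∈ B, f β ≤ m) (hm0 : 0 ≤ m) {μ : Site} (hμ : μ ∈ A) : f μ ≤ 1 / 2 * m := by
  obtain ⟨b, hb, hmax⟩ := hA.exists_maximalFor f A ⟨μ, hμ⟩
  have hle : ∀ g ∈ A, f g ≤ f b := fun g hg => by
    rcases le_total (f g) (f b) with h | h
    · exact h
    · exact hmax hg h
  -- If the maximum `f b` over `A` exceeds `m`, then `f b ≤ f b / 2`, hence `f b ≤ 0 ≤ m`.
  have h := hf b hb (max (f b) m) (by
    rintro g (hg | hg)
    · exact (hle g hg).trans (le_max_left _ _)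
    · exact (hm g hg).trans (le_max_right _ _))
  have h2 := hle μ hμ
  rcases le_total (f b) m with h' | h'
  · rw [max_eq_right h'] at h
    linarith
  · rw [max_eq_left h'] at h
    linarith

end ChalkerCoddington

theorem mainTheorem4 (s : ℝ) (hs0 : 0 < s) (hs1 : s < 1) :
    ∃ ℓ₀ φ₀ q : ℝ, 0 < ℓ₀ ∧ 0 < φ₀ ∧ q < 1 ∧
      ∀ L : ℕ × ℕ, 0 < L.1 → 0 < L.2 → ℓ₀ < ChalkerCoddington.size L →
      ∀ z : ℂ, ‖z‖ ≠ 1 →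
      ∀ φ : ℝ, |φ| < φ₀ →
      ∀ μ ν : ChalkerCoddington.Site,
        ν ∈ ChalkerCoddington.latticeInterior
          (ChalkerCoddington.shift (ChalkerCoddington.box L) (ChalkerCoddington.blockBase μ))ᶜ →
        (∀ β : ChalkerCoddington.Site,
          MeasureTheory.Integrable (ChalkerCoddington.resolventPower s φ z β ν)
            ChalkerCoddington.P) ∧
        ∃ m : ℝ,
          IsGreatest
            ((fun β => ChalkerCoddington.fracMoment s φ z β ν) ''
              ChalkerCoddington.nbhd (ChalkerCoddington.bdry
                (ChalkerCoddington.shift (ChalkerCoddington.box L)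
                  (ChalkerCoddington.blockBase μ))ᶜ)) m ∧
          ChalkerCoddington.fracMoment s φ z μ ν ≤ q * m := by
  open ChalkerCoddington in
  obtain ⟨φ₀, hφ₀, hdecay⟩ := exists_fracMoment_le hs0 hs1
  -- The value `q = 1 / 2` comes from four entry sites, each with weight `1 / 8`.
  refine ⟨1, φ₀, 1 / 2, one_pos, hφ₀, by norm_num, ?_⟩
  intro L hL1 hL2 _ z hz φ hφ μ ν hν
  refine ⟨fun β => integrable_resolventPower hs0 φ hz β ν, ?_⟩
  set A := shift (box L) (blockBase μ) with hA
  have hAfin : A.Finite := finite_shift_box _ _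
  set F := (fun β => fracMoment s φ z β ν) '' nbhd (bdry Aᶜ) with hF
  obtain ⟨m, hmF, hmax⟩ : ∃ m, IsGreatest F m := by
    have hFfin : F.Finite := (finite_nbhd_bdry_compl hAfin).image _
    have hFne : F.Nonempty := (nonempty_nbhd_bdry_shift_box hL1 hL2 _).image _
    exact ⟨sSup F, hFne.csSup_mem hFfin, fun x hx => le_csSup hFfin.bddAbove hx⟩
  refine ⟨m, ⟨hmF, hmax⟩, ?_⟩
  have hm : ∀ β ∈ nbhd (bdry Aᶜ), fracMoment s φ z β ν ≤ m :=
    fun β hβ => hmax ⟨β, hβ, rfl⟩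
  have hm0 : 0 ≤ m := by
    obtain ⟨β, _, rfl⟩ := hmF
    exact fracMoment_nonneg _ _ _ _ _
  refine le_half_of_submean (f := fun β => fracMoment s φ z β ν) hAfin ?_ hm hm0
    (self_mem_shift_box hL1 hL2 μ)
  intro b hb M hM
  -- The whole ring of `b` stays in the box, whereas `ν` lies outside it.
  have hring := ccwBack_iterate_mem_shift_box (μ := μ) hb
  refine (hdecay φ hφ z hz b ν fun j hj => hν.1 (hj ▸ hring j)).trans ?_
  have hsum : ∑ j, fracMoment s φ z (entrySite b j) ν ≤ ∑ _j : Fin 4, M := by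
    refine Finset.sum_le_sum fun j _ => hM _ ?_
    by_cases hj : entrySite b j ∈ A
    · exact Or.inl hj
    · exact Or.inr (cwBack_mem_nbhd_bdry (hring j) hj)
  rw [Finset.sum_const, Finset.card_univ, Fintype.card_fin, nsmul_eq_mul] at hsum
  push_cast at hsum
  linarith
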